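/- Let $D\ge 1$ and let $h_1,\dots,h_D$ be independent complex random variables with $h_j\sim\mathcal{CN}(0,\sigma_j^2)$ (circularly-symmetric complex Gaussian), $\sigma_j^2>0$; put $\mathbf h=(h_1,\dots,h_D)$, $\|\mathbf h\|^2=\sum_j|h_j|^2$ and $\sigma_{\min}^2=\min_j\sigma_j^2$. Let $\mathcal A_{\mathsf t},\mathcal A_{\mathsf r}$ be rectangular apertures of positive areas $\mu(\mathcal A_{\mathsf t}),\mu(\mathcal A_{\mathsf r})$, and let $\mu_{\mathsf t}=\mu(\mathcal A_{\mathsf t})\mu(\mathcal A_{\mathsf r})/D$. For an SNR $\bar\gamma>0$ the data rate of the MISO channel of the continuous aperture array (CAPA) is $\mathsf R(\bar\gamma)=\log_2(1+\bar\gamma\,\mu_{\mathsf t}\|\mathbf h\|^2)$, and its average data rate is $\mathcal R(\bar\gamma)=\mathbb E\{\mathsf R(\bar\gamma)\}$. Define $\psi_0=1$ and $\psi_q=\frac1q\sum_{k=1}^{q}\Big[\sum_{j=1}^{D}\big(1-\sigma_{\min}^2/\sigma_j^2\big)^k\Big]\psi_{q-k}$ for $q\ge1$. **Theorem.** (i)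 For every $\bar\gamma>0$ the average data rate is finite and, with $a=\bar\gamma\mu_{\mathsf t}\sigma_{\min}^2$, $$\mathcal R(\bar\gamma)=\frac{\sigma_{\min}^{2D}}{\prod_{j=1}^{D}\sigma_j^2}\sum_{q=0}^{\infty}\sum_{v=0}^{D+q-1}\frac{\psi_q/\log 2}{(D+q-1-v)!}\left[\frac{(-1)^{D+q-v}e^{1/a}}{a^{D+q-1-v}}\,\mathrm{Ei}\!\left(-\frac1a\right)+\sum_{u=1}^{D+q-1-v}(u-1)!\left(-\frac1a\right)^{D+q-1-v-u}\right],$$ where the series over $q$ (of the finite inner sums) converges absolutely and $\mathrm{Ei}(x)=-\int_{-x}^{\infty}e^{-t}t^{-1}\,dt$ for $x<0$. (ii) As $\bar\gamma\to\infty$, $\mathcal R(\bar\gamma)\simeq\log_2\bar\gamma-\mathcal L$, in the sense that $\mathcal R(\bar\gamma)-(\log_2\bar\gamma-\mathcal L)\to0$ and $\mathcal R(\bar\gamma)/(\log_2\bar\gamma-\mathcal L)\to1$, where $\log_2(\mu_{\mathsf t}\|\mathbf h\|^2)$ is integrable and $$\mathcal L=-\mathbb E\{\log_2(\mu_{\mathsf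 t}\|\mathbf h\|^2)\}=-\log_2\mu_{\mathsf t}-\frac{\sigma_{\min}^{2D}}{\prod_{j=1}^{D}\sigma_j^2}\sum_{q=0}^{\infty}\frac{\psi_q\big(\psi(D+q)+\log\sigma_{\min}^2\big)}{\log 2},$$ with an absolutely convergent series; here $\psi(x)=\frac{d}{dx}\ln\Gamma(x)$ is the digamma function. (iii) Hence the maximal multiplexing gain is $\lim_{\bar\gamma\to\infty}\mathcal R(\bar\gamma)/\log_2(1+\bar\gamma)=1$. -/

import Mathlib

open MeasureTheory ProbabilityTheory Filter Topology
open scoped NNReal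

noncomputable section

namespace CAPA

/-- The circularly-symmetric complex Gaussian distribution `CN(0, v)`: real and imaginary parts
are independent real Gaussians with mean `0` and variance `v / 2`. -/
def circularGaussian (v : ℝ) : Measure ℂ :=
  ((gaussianReal 0 (v / 2).toNNReal).prod (gaussianReal 0 (v / 2).toNNReal)).map
    Complex.measurableEquivRealProd.symm

/-- A planar rectangular aperture with side lengths `Lx`, `Lz`, in the coordinates of its plane. -/
def aperture (Lx Lz : ℝ) : Set (ℝ × ℝ) :=
  Set.Icc (-(Lx / 2)) (Lx / 2) ×ˢ Set.Icc (-(Lz / 2)) (Lz / 2)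

/-- The squared Euclidean norm `‖h‖²` of the channel vector `h ∈ ℂ^D`. -/
def channelGain {D : ℕ} (h : Fin D → ℂ) : ℝ := ‖WithLp.toLp 2 h‖ ^ 2

/-- The data rate `log₂ (1 + (At² Ar / N₀) hᵀ Q h*)` of the scalar channel
`y = At Ar hᵀ s + z` with symbol covariance `Q = E{s sᴴ}` and noise variance `N₀ Ar`, where
`At`, `Ar` are the aperture areas and `N₀` is the noise strength. -/
def covarianceRate {D : ℕ} (At Ar N₀ : ℝ) (Q : Matrix (Fin D) (Fin D) ℂ) (h : Fin D → ℂ) : ℝ :=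
  Real.logb 2 (1 + At ^ 2 * Ar / N₀ * (h ⬝ᵥ Q.mulVec (star h)).re)

/-- The MISO data rate `log₂ (1 + γ ‖h‖² μt)` at SNR `γ`, where `μt = At Ar / D`. -/
def misoRate {D : ℕ} (μt γ : ℝ) (h : Fin D → ℂ) : ℝ :=
  Real.logb 2 (1 + γ * channelGain h * μt)

/-- `misoRate` is the rate for i.i.d. symbols of total power `P`, i.e. `E{s sᴴ} = (P / D) I`,
with SNR `γ = At P / N₀`. -/
theorem covarianceRate_iid {D : ℕ} (At Ar N₀ P : ℝ) (h : Fin D → ℂ) :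
    covarianceRate At Ar N₀ ((((P / D : ℝ) : ℂ)) • (1 : Matrix (Fin D) (Fin D) ℂ)) h =
      misoRate (At * Ar / D) (At * P / N₀) h := by
  have hre : (h ⬝ᵥ ((((P / D : ℝ) : ℂ)) • (1 : Matrix (Fin D) (Fin D) ℂ)).mulVec (star h)).re
      = P / D * channelGain h := by
    rw [Matrix.smul_mulVec, Matrix.one_mulVec, dotProduct_smul, smul_eq_mul, Complex.re_ofReal_mul]
    congr 1
    simp only [channelGain, EuclideanSpace.norm_sq_eq, dotProduct, Pi.star_apply, Complex.re_sum]
    refine Finset.sum_congr rfl fun j _ => ?_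
    rw [Complex.star_def, Complex.mul_conj, Complex.ofReal_re, Complex.normSq_eq_norm_sq]
  rw [covarianceRate, misoRate, hre]
  congr 2
  ring

/-- The smallest variance `σ²_min = min_j σ²_j` (for `D ≥ 1`). -/
def minVar {D : ℕ} (V : Fin D → ℝ) : ℝ := ⨅ j, V j

/-- The coefficients `ψ_q`: `ψ_0 = 1` and
`ψ_q = ∑_{k=1}^q (∑_j (1 - σ²_min / σ²_j)^k) ψ_{q-k} / q` for `q ≥ 1`
(the sum below is indexed by `k - 1`). -/
def seriesCoeff {D : ℕ} (V : Fin D → ℝ) : ℕ → ℝ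
  | 0 => 1
  | q + 1 => ∑ k : Fin (q + 1),
      (∑ j, (1 - minVar V / V j) ^ ((k : ℕ) + 1)) * (seriesCoeff V (q - k) / ((q + 1 : ℕ) : ℝ))

/-- The prefactor `σ_min^{2D} / ∏_j σ²_j`. -/
def prefactor {D : ℕ} (V : Fin D → ℝ) : ℝ := minVar V ^ D / ∏ j, V j

/-- The exponential integral `Ei(x) = -∫_{-x}^∞ e^{-t} / t dt`; only negative arguments are
used, for which the integral converges absolutely. -/
def expIntegralEi (x : ℝ) : ℝ := -∫ t in Set.Ioi (-x), Real.exp (-t) / t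

/-- Euler's digamma function `ψ(x) = d/dx ln Γ(x)` on the positive reals. -/
def realDigamma (x : ℝ) : ℝ := deriv (fun y => Real.log (Real.Gamma y)) x

/-- The `q`-th summand of the series for the average rate, with `a = γ μt σ²_min`. -/
def rateTerm {D : ℕ} (V : Fin D → ℝ) (a : ℝ) (q : ℕ) : ℝ :=
  ∑ v ∈ Finset.range (D + q),
    seriesCoeff V q / Real.log 2 / ((D + q - 1 - v).factorial : ℝ) *
      ((-1) ^ (D + q - v) * Real.exp (1 / a) / a ^ (D + q - 1 - v) * expIntegralEi (-1 / a)
        + ∑ u ∈ Finset.Icc 1 (D + q - 1 - v),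
            ((u - 1).factorial : ℝ) * (-1 / a) ^ (D + q - 1 - v - u))

/-- The `q`-th summand of the digamma series for the power offset. -/
def offsetTerm {D : ℕ} (V : Fin D → ℝ) (q : ℕ) : ℝ :=
  seriesCoeff V q * (realDigamma ((D + q : ℕ) : ℝ) + Real.log (minVar V)) / Real.log 2

/-- The average data rate `E{R}` at SNR `γ` of the random channel vector `h`. -/
def averageRate {Ω : Type*} [MeasurableSpace Ω] (P : Measure Ω) {D : ℕ} (h : Fin D → Ω → ℂ)
    (μt γ : ℝ) : ℝ :=
  ∫ ω, misoRate μt γ (fun j => h j ω) ∂P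

/-- The high-SNR power offset `-E{log₂ (μt ‖h‖²)}`. -/
def powerOffset {Ω : Type*} [MeasurableSpace Ω] (P : Measure Ω) {D : ℕ} (h : Fin D → Ω → ℂ)
    (μt : ℝ) : ℝ :=
  -∫ ω, Real.logb 2 (μt * channelGain (fun j => h j ω)) ∂P

end CAPA

end

/-! Write σ² for the smallest variance and δ_j = 1 - σ²/σ_j². The variable X = ‖h‖²/σ² is a mixture
of Gamma laws of shapes D + q and unit rate, with weights `prefactor V * seriesCoeff V q`
(`hasLaw_channelGain_div_minVar`). Indeed its characteristic function is ∏ (1 - i t σ_j²/σ²)⁻¹. With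
w = (1 - i t)⁻¹, each factor equals w (σ²/σ_j²) / (1 - δ_j w). Expanding ∏ (1 - δ_j w)⁻¹ in powers
of w leaves multiples of w^(D+q), the characteristic function of Gamma(D + q, 1). The recursion for
ψ_q is Newton's identity for the coefficients of this product (`seriesCoeff_eq_coeff`).

Expectations of functions of X therefore become series of Gamma integrals. For log(1 + a x),
integration by parts followed by division by x + 1/a gives the finite sums with Ei. For log x, the
integral is Γ'/Γ at D + q. Absolute convergence comes from integrability against the mixture.

At high SNR, log(1 + γY) - log γ = log(γ⁻¹ + Y), and dominated convergence gives the offset E log Y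
(`tendsto_integral_log_one_add_mul`). The ratio limits follow because the denominators tend to
infinity. -/

noncomputable section

namespace CAPA


/-! ### The generating function of the mixture coefficients -/

/-- The formal geometric series `1 / (1 - δ X)`. -/
def geomSeries (δ : ℝ) : PowerSeries ℝ := PowerSeries.mk fun n => δ ^ n

lemma derivative_geomSeries (δ : ℝ) :
    PowerSeries.derivative ℝ (geomSeries δ) = PowerSeries.C δ * geomSeries δ * geomSeries δ := by
  ext n
  have h : ∀ p ∈ Finset.HasAntidiagonal.antidiagonal n,
      PowerSeries.coeff p.1 (geomSeries δ) * PowerSeries.coeff p.2 (geomSeries δ) = δ ^ n := by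
    intro p hp
    simp [geomSeries, ← pow_add, Finset.HasAntidiagonal.mem_antidiagonal.mp hp]
  rw [PowerSeries.coeff_derivative, mul_assoc, PowerSeries.coeff_C_mul, PowerSeries.coeff_mul,
    Finset.sum_congr rfl h]
  simp [geomSeries, pow_succ]
  ring

lemma derivative_prod_geomSeries {ι : Type*} (s : Finset ι) (δ : ι → ℝ) :
    PowerSeries.derivative ℝ (∏ j ∈ s, geomSeries (δ j)) =
      (∑ j ∈ s, PowerSeries.C (δ j) * geomSeries (δ j)) * ∏ j ∈ s, geomSeries (δ j) := by
  classical
  induction s using Finset.induction_on with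
  | empty => simp
  | insert a s ha ih =>
    rw [Finset.prod_insert ha, Finset.sum_insert ha, Derivation.leibniz, ih,
      derivative_geomSeries, smul_eq_mul, smul_eq_mul]
    ring

/-- Newton's identity: compare coefficients in F' = (F'/F) F, where the logarithmic derivative ∑ δ_j
/ (1 - δ_j X) has the power sums of the δ_j as coefficients. -/
lemma coeff_prod_geomSeries_succ {ι : Type*} (s : Finset ι) (δ : ι → ℝ) (q : ℕ) :
    PowerSeries.coeff (q + 1) (∏ j ∈ s, geomSeries (δ j)) * (q + 1) =
      ∑ k ∈ Finset.range (q + 1), (∑ j ∈ s, δ j ^ (k + 1)) *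
        PowerSeries.coeff (q - k) (∏ j ∈ s, geomSeries (δ j)) := by
  rw [← PowerSeries.coeff_derivative, derivative_prod_geomSeries, PowerSeries.coeff_mul,
    Finset.Nat.sum_antidiagonal_eq_sum_range_succ_mk]
  refine Finset.sum_congr rfl fun k _ => ?_
  simp [geomSeries, map_sum, pow_succ']

lemma seriesCoeff_eq_coeff {D : ℕ} (V : Fin D → ℝ) (q : ℕ) :
    seriesCoeff V q = PowerSeries.coeff q (∏ j, geomSeries (1 - minVar V / V j)) := by
  induction q using Nat.strong_induction_on with
  | _ q ih =>
    cases q with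
    | zero =>
      rw [seriesCoeff, PowerSeries.coeff_zero_eq_constantCoeff_apply, map_prod]
      refine (Finset.prod_eq_one fun j _ => ?_).symm
      rw [← PowerSeries.coeff_zero_eq_constantCoeff_apply]
      simp [geomSeries]
    | succ q =>
      have h := coeff_prod_geomSeries_succ Finset.univ (fun j => 1 - minVar V / V j) q
      have hq : ((q : ℝ) + 1) ≠ 0 := by positivity
      rw [seriesCoeff, ← mul_right_cancel_iff_of_pos (by positivity : (0 : ℝ) < q + 1), h,
        Finset.sum_range, Finset.sum_mul]
      refine Finset.sum_congr rfl fun k _ => ?_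
      rw [ih (q - k) (by omega)]
      push_cast
      field_simp

lemma coeff_prod_geomSeries_nonneg {ι : Type*} (s : Finset ι) (δ : ι → ℝ)
    (hδ : ∀ j ∈ s, 0 ≤ δ j) (q : ℕ) :
    0 ≤ PowerSeries.coeff q (∏ j ∈ s, geomSeries (δ j)) := by
  classical
  induction s using Finset.induction_on generalizing q with
  | empty => rw [Finset.prod_empty, PowerSeries.coeff_one]; split_ifs <;> simp
  | insert a s ha ih =>
    rw [Finset.prod_insert ha, PowerSeries.coeff_mul]
    refine Finset.sum_nonneg fun p _ => mul_nonneg ?_ (ih (fun j hj => hδ j (by simp [hj])) _)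
    simpa [geomSeries] using pow_nonneg (hδ a (by simp)) _

/-- The closed disc is needed: z = 1 gives the total mass of the mixture. It is allowed because
|δ_j| < 1. -/
lemma hasSum_coeff_prod_geomSeries {ι : Type*} (s : Finset ι) (δ : ι → ℝ)
    (hδ : ∀ j ∈ s, |δ j| < 1) {z : ℂ} (hz : ‖z‖ ≤ 1) :
    HasSum (fun q => ((PowerSeries.coeff q (∏ j ∈ s, geomSeries (δ j)) : ℝ) : ℂ) * z ^ q)
      (∏ j ∈ s, (1 - δ j * z)⁻¹) := by
  classical
  -- The induction carries norm-summability, which the Cauchy product requires.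
  suffices H : Summable (fun q =>
      ‖((PowerSeries.coeff q (∏ j ∈ s, geomSeries (δ j)) : ℝ) : ℂ) * z ^ q‖) ∧
      ∑' q, ((PowerSeries.coeff q (∏ j ∈ s, geomSeries (δ j)) : ℝ) : ℂ) * z ^ q =
        ∏ j ∈ s, (1 - δ j * z)⁻¹ from H.2 ▸ H.1.of_norm.hasSum
  induction s using Finset.induction_on with
  | empty =>
    have h0 : ∀ q, ((PowerSeries.coeff q (1 : PowerSeries ℝ) : ℝ) : ℂ) * z ^ q
        = if q = 0 then 1 else 0 := by
      intro q
      rw [PowerSeries.coeff_one]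
      split_ifs with hq <;> simp [hq]
    simp only [Finset.prod_empty, h0]
    refine ⟨summable_of_ne_finset_zero (s := {0}) fun q hq => ?_, by simp⟩
    simp at hq
    simp [hq]
  | insert a s ha ih =>
    obtain ⟨ih₁, ih₂⟩ := ih fun j hj => hδ j (by simp [hj])
    have hnorm : ‖(δ a : ℂ) * z‖ < 1 := by
      rw [norm_mul, Complex.norm_real, Real.norm_eq_abs]
      exact (mul_le_of_le_one_right (abs_nonneg _) hz).trans_lt (hδ a (by simp))
    have hg : Summable fun q => ‖((δ a : ℂ) * z) ^ q‖ := by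
      simpa only [norm_pow] using summable_geometric_of_lt_one (norm_nonneg _) hnorm
    have hcoeff : ∀ q,
        ((PowerSeries.coeff q (∏ j ∈ insert a s, geomSeries (δ j)) : ℝ) : ℂ) * z ^ q =
        ∑ kl ∈ Finset.HasAntidiagonal.antidiagonal q, ((δ a : ℂ) * z) ^ kl.1 *
          (((PowerSeries.coeff kl.2 (∏ j ∈ s, geomSeries (δ j)) : ℝ) : ℂ) * z ^ kl.2) := by
      intro q
      rw [Finset.prod_insert ha, PowerSeries.coeff_mul, Complex.ofReal_sum, Finset.sum_mul]
      refine Finset.sum_congr rfl fun kl hkl => ?_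
      rw [← Finset.HasAntidiagonal.mem_antidiagonal.mp hkl]
      simp only [geomSeries, PowerSeries.coeff_mk]
      push_cast
      ring
    have hprod := tsum_mul_tsum_eq_tsum_sum_antidiagonal_of_summable_norm hg ih₁
    have hsum := summable_norm_sum_mul_antidiagonal_of_summable_norm hg ih₁
    rw [ih₂, tsum_geometric_of_norm_lt_one hnorm] at hprod
    simp only [hcoeff, Finset.prod_insert ha (f := fun j => (1 - (δ j : ℂ) * z)⁻¹)]
    exact ⟨hsum, hprod.symm⟩

/-! ### Positivity and total mass of the mixture weights -/

section Variances

variable {D : ℕ} {V : Fin D → ℝ}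

lemma minVar_pos (hD : 1 ≤ D) (hV : ∀ j, 0 < V j) : 0 < minVar V := by
  have : Nonempty (Fin D) := ⟨⟨0, hD⟩⟩
  obtain ⟨j, hj⟩ := exists_eq_ciInf_of_finite (f := V)
  rw [minVar, ← hj]
  exact hV j

lemma minVar_div_mem (hD : 1 ≤ D) (hV : ∀ j, 0 < V j) (j : Fin D) :
    0 < minVar V / V j ∧ minVar V / V j ≤ 1 :=
  ⟨div_pos (minVar_pos hD hV) (hV j),
    (div_le_one (hV j)).mpr (ciInf_le (Set.finite_range V).bddBelow j)⟩

/-- The weights of the Gamma mixture. -/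
def mixtureWeight (V : Fin D → ℝ) (q : ℕ) : ℝ := prefactor V * seriesCoeff V q

lemma prefactor_eq_prod (V : Fin D → ℝ) : prefactor V = ∏ j, minVar V / V j := by
  simp [prefactor, Finset.prod_div_distrib]

lemma prefactor_pos (hD : 1 ≤ D) (hV : ∀ j, 0 < V j) : 0 < prefactor V := by
  rw [prefactor_eq_prod]
  exact Finset.prod_pos fun j _ => (minVar_div_mem hD hV j).1

lemma mixtureWeight_nonneg (hD : 1 ≤ D) (hV : ∀ j, 0 < V j) (q : ℕ) : 0 ≤ mixtureWeight V q := by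
  rw [mixtureWeight, seriesCoeff_eq_coeff]
  exact mul_nonneg (prefactor_pos hD hV).le (coeff_prod_geomSeries_nonneg _ _
    (fun j _ => sub_nonneg.mpr (minVar_div_mem hD hV j).2) q)

lemma hasSum_mixtureWeight_mul_pow (hD : 1 ≤ D) (hV : ∀ j, 0 < V j) {z : ℂ} (hz : ‖z‖ ≤ 1) :
    HasSum (fun q => (mixtureWeight V q : ℂ) * z ^ q)
      (∏ j, (minVar V / V j : ℝ) / (1 - (1 - minVar V / V j : ℝ) * z)) := by
  have h := (hasSum_coeff_prod_geomSeries Finset.univ (fun j => 1 - minVar V / V j)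
    (fun j _ => by
      have := minVar_div_mem hD hV j
      rw [abs_lt]; constructor <;> linarith) hz).mul_left (prefactor V : ℂ)
  have hprod : (prefactor V : ℂ) * ∏ j, (1 - ((1 - minVar V / V j : ℝ) : ℂ) * z)⁻¹ =
      ∏ j, (minVar V / V j : ℝ) / (1 - (1 - minVar V / V j : ℝ) * z) := by
    rw [prefactor_eq_prod, Complex.ofReal_prod, ← Finset.prod_mul_distrib]
    simp only [div_eq_mul_inv]
  rw [hprod] at h
  simpa only [mixtureWeight, seriesCoeff_eq_coeff, Complex.ofReal_mul, mul_assoc] using h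

lemma hasSum_mixtureWeight (hD : 1 ≤ D) (hV : ∀ j, 0 < V j) : HasSum (mixtureWeight V) 1 := by
  have h := hasSum_mixtureWeight_mul_pow hD hV (z := 1) (by simp)
  rw [Finset.prod_eq_one] at h
  · simpa [← Complex.hasSum_ofReal] using h
  · intro j _
    have := (minVar_div_mem hD hV j).1.ne'
    push_cast at this ⊢
    rw [mul_one, sub_sub_cancel, div_self]
    exact_mod_cast this

end Variances


/-! ### Gamma distributions of integer shape and unit rate -/

section GammaIntegrals
open Set

lemma integrableOn_pow_mul_exp_neg_mul (m : ℕ) {r : ℝ} (hr : 0 < r) :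
    IntegrableOn (fun x : ℝ => x ^ m * Real.exp (-r * x)) (Ioi 0) := by
  have h := integrableOn_rpow_mul_exp_neg_mul_rpow (p := 1) (s := m) (b := r)
    (by have := (Nat.cast_nonneg m : (0 : ℝ) ≤ m); linarith) one_pos hr
  simpa using h

lemma integrableOn_pow_mul_exp_neg (m : ℕ) :
    IntegrableOn (fun x : ℝ => x ^ m * Real.exp (-x)) (Ioi 0) := by
  simpa using integrableOn_pow_mul_exp_neg_mul m one_pos

lemma integrableOn_pow_mul_cexp (m : ℕ) {c : ℂ} (hc : 0 < c.re) :
    IntegrableOn (fun x : ℝ => (x : ℂ) ^ m * Complex.exp (-c * x)) (Ioi 0) := by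
  refine (integrableOn_pow_mul_exp_neg_mul m hc).mono'
    (by fun_prop) ((ae_restrict_mem measurableSet_Ioi).mono fun x hx => ?_)
  rw [norm_mul, norm_pow, Complex.norm_real, Complex.norm_exp, Real.norm_of_nonneg (le_of_lt hx)]
  simp

/-- Integrating the derivative of x^(m+1) e^(-cx) gives c I_(m+1) = (m+1) I_m. Complex c serves the
characteristic function, where c = 1 - i t. -/
lemma integral_pow_mul_cexp (m : ℕ) {c : ℂ} (hc : 0 < c.re) :
    ∫ x in Ioi (0 : ℝ), (x : ℂ) ^ m * Complex.exp (-c * x) = m.factorial * (c⁻¹) ^ (m + 1) := by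
  have hc0 : c ≠ 0 := by rintro rfl; simp at hc
  induction m with
  | zero =>
    have h := integral_exp_mul_complex_Ioi (a := -c) (by simpa using hc) 0
    simp only [pow_zero, one_mul]
    rw [h]
    simp
  | succ m ih =>
    have hd : ∀ x : ℝ, HasDerivAt (fun x : ℝ => (x : ℂ) ^ (m + 1) * Complex.exp (-c * x))
        ((m + 1) * ((x : ℂ) ^ m * Complex.exp (-c * x)) -
          c * ((x : ℂ) ^ (m + 1) * Complex.exp (-c * x))) x := by
      intro x
      have h1 : HasDerivAt (fun z : ℂ => z ^ (m + 1) * Complex.exp (-c * z))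
        ((m + 1) * ((x : ℂ) ^ m * Complex.exp (-c * x)) -
          c * ((x : ℂ) ^ (m + 1) * Complex.exp (-c * x))) (x : ℂ) := by
        have := (hasDerivAt_pow (m + 1) (x : ℂ)).mul
          (((hasDerivAt_id (x : ℂ)).const_mul (-c)).cexp)
        refine this.congr_deriv ?_
        simp
        ring
      exact h1.comp_ofReal
    have i1 := (integrableOn_pow_mul_cexp m hc).const_mul ((m : ℂ) + 1)
    have i2 := (integrableOn_pow_mul_cexp (m + 1) hc).const_mul c
    -- The boundary term at infinity vanishes because the function and its derivative are both
    -- integrable.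
    have h := integral_Ioi_of_hasDerivAt_of_tendsto' (a := 0) (fun x _ => hd x) (i1.sub i2)
      (tendsto_zero_of_hasDerivAt_of_integrableOn_Ioi (fun x _ => hd x) (i1.sub i2)
        (integrableOn_pow_mul_cexp (m + 1) hc))
    rw [integral_sub i1 i2, integral_const_mul, integral_const_mul, ih] at h
    simp only [Complex.ofReal_zero, ne_eq, Nat.add_eq_zero_iff, one_ne_zero, and_false,
      not_false_eq_true, zero_pow, zero_mul, sub_zero] at h
    rw [sub_eq_zero] at h
    rw [pow_succ c⁻¹ (m + 1), Nat.factorial_succ, ← mul_right_inj' hc0, ← h]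
    push_cast
    field_simp

lemma integral_pow_mul_exp_neg (m : ℕ) :
    ∫ x in Ioi (0 : ℝ), x ^ m * Real.exp (-x) = m.factorial := by
  rw [← Real.Gamma_nat_eq_factorial, Real.Gamma_eq_integral (by positivity)]
  refine setIntegral_congr_fun measurableSet_Ioi fun x _ => ?_
  simp [mul_comm]

lemma gammaPDFReal_natCast {n : ℕ} (hn : 0 < n) {x : ℝ} (hx : 0 ≤ x) :
    gammaPDFReal n 1 x = x ^ (n - 1) * Real.exp (-x) / (n - 1).factorial := by
  obtain ⟨m, rfl⟩ := Nat.exists_eq_succ_of_ne_zero hn.ne'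
  rw [gammaPDFReal, if_pos hx]
  push_cast
  rw [Real.Gamma_nat_eq_factorial]
  simp
  ring

lemma integral_gammaMeasure_natCast {E : Type*} [NormedAddCommGroup E] [NormedSpace ℝ E]
    {n : ℕ} (hn : 0 < n) (f : ℝ → E) :
    ∫ x, f x ∂gammaMeasure n 1 =
      ∫ x in Ioi (0 : ℝ), (x ^ (n - 1) * Real.exp (-x) / (n - 1).factorial) • f x := by
  have hm : Measurable (gammaPDF n 1) := (measurable_gammaPDFReal _ _).ennreal_ofReal
  rw [gammaMeasure, integral_withDensity_eq_integral_toReal_smul hm (ae_of_all _ fun _ => ENNReal.ofReal_lt_top),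
    ← integral_Ici_eq_integral_Ioi, ← integral_indicator measurableSet_Ici]
  congr 1 with x
  by_cases hx : 0 ≤ x
  · rw [indicator_of_mem (mem_Ici.mpr hx), gammaPDF,
      ENNReal.toReal_ofReal (gammaPDFReal_nonneg (by positivity) one_pos x),
      gammaPDFReal_natCast hn hx]
  · rw [indicator_of_notMem (by simpa using hx), gammaPDF_of_neg (not_le.mp hx)]
    simp

lemma charFun_gammaMeasure_natCast {n : ℕ} (hn : 0 < n) (t : ℝ) :
    charFun (gammaMeasure n 1) t = ((1 - t * Complex.I)⁻¹) ^ n := by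
  have h := integral_pow_mul_cexp (n - 1) (c := 1 - t * Complex.I) (by simp)
  rw [Nat.sub_add_cancel hn] at h
  have hf : ((n - 1).factorial : ℂ) ≠ 0 := by exact_mod_cast Nat.factorial_ne_zero _
  rw [charFun_apply_real, integral_gammaMeasure_natCast hn,
    ← mul_right_inj' hf, ← h, ← integral_const_mul]
  refine setIntegral_congr_fun measurableSet_Ioi fun x _ => ?_
  have hexp : -(1 - (t : ℂ) * Complex.I) * x = -x + t * x * Complex.I := by ring
  simp only [Complex.real_smul, hexp, Complex.exp_add]
  push_cast
  field_simp

/-- The density x^m e^(-x) / m! is at most 1, since x^m / m! is one term of the series of e^x. This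
bound, uniform in the shape, passes to the mixture and controls log near 0. -/
lemma gammaMeasure_natCast_le_volume {n : ℕ} (hn : 0 < n) : gammaMeasure n 1 ≤ volume := by
  calc gammaMeasure n 1 ≤ volume.withDensity 1 := by
        refine withDensity_mono (ae_of_all _ fun x => ?_)
        by_cases hx : 0 ≤ x
        · rw [gammaPDF, gammaPDFReal_natCast hn hx, Pi.one_apply, ENNReal.ofReal_le_one,
            mul_div_right_comm, Real.exp_neg, ← div_eq_mul_inv, div_le_one (Real.exp_pos x)]
          exact Real.pow_div_factorial_le_exp x hx _
        · simp [gammaPDF_of_neg (not_le.mp hx)]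
    _ = volume := withDensity_one

lemma gammaMeasure_Iic_zero (a r : ℝ) : gammaMeasure a r (Iic 0) = 0 := by
  rw [gammaMeasure, withDensity_apply _ measurableSet_Iic, ← setLIntegral_congr Iio_ae_eq_Iic]
  exact lintegral_gammaPDF_of_nonpos le_rfl

/-- Differentiating Euler's integral under the integral sign gives Γ'(n) = ∫ x^(n-1) log x e^(-x);
dividing by Γ(n) = (n-1)! gives (log Γ)'(n). -/
lemma integral_log_gammaMeasure {n : ℕ} (hn : 0 < n) :
    ∫ x, Real.log x ∂gammaMeasure n 1 = realDigamma n := by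
  have hn' : (0 : ℝ) < n := by exact_mod_cast hn
  have hG : HasDerivAt Real.Gamma
      (∫ x in Ioi (0 : ℝ), x ^ (n - 1) * (Real.log x * Real.exp (-x))) n := by
    have h := Complex.hasDerivAt_GammaIntegral (s := (n : ℝ)) (by simpa using hn)
    have hint : (∫ t : ℝ in Ioi 0, (t : ℂ) ^ (((n : ℝ) : ℂ) - 1) *
        (Real.log t * Real.exp (-t) : ℂ)) =
        ((∫ x in Ioi (0 : ℝ), x ^ (n - 1) * (Real.log x * Real.exp (-x)) : ℝ) : ℂ) := by
      rw [← integral_complex_ofReal]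
      refine setIntegral_congr_fun measurableSet_Ioi fun x _ => ?_
      have : (((n : ℝ) : ℂ) - 1) = ((n - 1 : ℕ) : ℂ) := by
        rw [Nat.cast_sub hn]; simp
      simp only [this, Complex.cpow_natCast]
      push_cast
      rfl
    rw [hint] at h
    have h2 := h.real_of_complex
    rw [Complex.ofReal_re] at h2
    -- Euler's integral is identified with Γ only at positive arguments, hence only near n.
    refine h2.congr_of_eventuallyEq ?_
    filter_upwards [lt_mem_nhds hn'] with y hy
    rw [← Complex.Gamma_eq_integral (by simpa using hy), Complex.Gamma_ofReal, Complex.ofReal_re]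
  have hpos : Real.Gamma n ≠ 0 := (Real.Gamma_pos_of_pos hn').ne'
  rw [realDigamma, (hG.log hpos).deriv, integral_gammaMeasure_natCast hn, ← integral_div]
  refine setIntegral_congr_fun measurableSet_Ioi fun x _ => ?_
  have hfac : Real.Gamma n = (n - 1).factorial := by
    rw [← Real.Gamma_nat_eq_factorial, Nat.cast_sub hn]; simp
  simp only [hfac, smul_eq_mul]
  ring

/-! ### The logarithmic moment `E log (1 + a X)` of a Gamma variable -/

lemma integrableOn_pow_mul_exp_neg_div (m : ℕ) {b : ℝ} (hb : 0 < b) :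
    IntegrableOn (fun x : ℝ => x ^ m * Real.exp (-x) / (x + b)) (Ioi 0) := by
  refine ((integrableOn_pow_mul_exp_neg m).div_const b).mono'
    (by refine Measurable.aestronglyMeasurable ?_; fun_prop)
    ((ae_restrict_mem measurableSet_Ioi).mono fun x hx => ?_)
  have hx : (0 : ℝ) < x := hx
  rw [Real.norm_of_nonneg (by positivity)]
  gcongr
  linarith

lemma integral_exp_neg_div_add {b : ℝ} :
    ∫ x in Ioi (0 : ℝ), Real.exp (-x) / (x + b) = -(Real.exp b * expIntegralEi (-b)) := by
  have h := (measurePreserving_add_right (volume : Measure ℝ) b).setIntegral_preimage_emb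
    (measurableEmbedding_addRight b) (fun t => Real.exp (-t) / t) (Ioi b)
  rw [expIntegralEi, neg_neg, mul_neg, neg_neg, ← h, ← integral_const_mul]
  have hs : (fun x => x + b) ⁻¹' Ioi b = Ioi 0 := by ext x; simp
  rw [hs]
  refine setIntegral_congr_fun measurableSet_Ioi fun x _ => ?_
  simp only [neg_add, Real.exp_add, Real.exp_neg b]
  field_simp

/-- Since x^(m+1)/(x+b) = x^m - b x^m/(x+b), each step multiplies the previous value by -b and adds
m!. The case m = 0 is the exponential integral. -/
lemma integral_pow_mul_exp_neg_div (m : ℕ) {b : ℝ} (hb : 0 < b) :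
    ∫ x in Ioi (0 : ℝ), x ^ m * Real.exp (-x) / (x + b) =
      (-1) ^ (m + 1) * Real.exp b * b ^ m * expIntegralEi (-b) +
        ∑ u ∈ Finset.Icc 1 m, ((u - 1).factorial : ℝ) * (-b) ^ (m - u) := by
  induction m with
  | zero => simp [integral_exp_neg_div_add]
  | succ m ih =>
    have h : ∫ x in Ioi (0 : ℝ), x ^ (m + 1) * Real.exp (-x) / (x + b) =
        (∫ x in Ioi (0 : ℝ), x ^ m * Real.exp (-x)) -
          b * ∫ x in Ioi (0 : ℝ), x ^ m * Real.exp (-x) / (x + b) := by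
      rw [← integral_const_mul, ← integral_sub (integrableOn_pow_mul_exp_neg m)
        ((integrableOn_pow_mul_exp_neg_div m hb).const_mul b)]
      refine setIntegral_congr_fun measurableSet_Ioi fun x hx => ?_
      have hx : (0 : ℝ) < x := hx
      field_simp
      ring
    have hs : ∑ u ∈ Finset.Icc 1 m, ((u - 1).factorial : ℝ) * (-b) ^ (m + 1 - u) =
        -b * ∑ u ∈ Finset.Icc 1 m, ((u - 1).factorial : ℝ) * (-b) ^ (m - u) := by
      rw [Finset.mul_sum]
      refine Finset.sum_congr rfl fun u hu => ?_
      rw [Nat.sub_add_comm (Finset.mem_Icc.mp hu).2, pow_succ]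
      ring
    rw [h, ih, integral_pow_mul_exp_neg, Finset.sum_Icc_succ_top (by omega), hs]
    simp
    ring

lemma log_one_add_mul_le {a x : ℝ} (ha : 0 < a) (hx : 0 < x) :
    Real.log (1 + a * x) ≤ a * x := by
  have := Real.log_le_sub_one_of_pos (x := 1 + a * x) (by positivity)
  linarith

lemma log_one_add_mul_nonneg {a x : ℝ} (ha : 0 < a) (hx : 0 < x) :
    0 ≤ Real.log (1 + a * x) :=
  Real.log_nonneg (by have := mul_pos ha hx; linarith)

lemma integrableOn_pow_mul_exp_neg_mul_log (m : ℕ) {a : ℝ} (ha : 0 < a) :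
    IntegrableOn (fun x : ℝ => x ^ m * Real.exp (-x) * Real.log (1 + a * x)) (Ioi 0) := by
  refine ((integrableOn_pow_mul_exp_neg (m + 1)).mul_const a).mono' (by fun_prop)
    ((ae_restrict_mem measurableSet_Ioi).mono fun x hx => ?_)
  have hx : (0 : ℝ) < x := hx
  have h1 := log_one_add_mul_le ha hx
  have h0 := log_one_add_mul_nonneg ha hx
  rw [Real.norm_of_nonneg (by positivity)]
  calc x ^ m * Real.exp (-x) * Real.log (1 + a * x) ≤ x ^ m * Real.exp (-x) * (a * x) := by gcongr
    _ = _ := by ring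

/-- Integration by parts; the boundary term at 0 vanishes because log 1 = 0. At m = 0 the truncated
exponent `m - 1` is harmless, being multiplied by m. -/
lemma integral_pow_mul_exp_neg_mul_log (m : ℕ) {a : ℝ} (ha : 0 < a) :
    ∫ x in Ioi (0 : ℝ), x ^ m * Real.exp (-x) * Real.log (1 + a * x) =
      m * (∫ x in Ioi (0 : ℝ), x ^ (m - 1) * Real.exp (-x) * Real.log (1 + a * x)) +
        ∫ x in Ioi (0 : ℝ), x ^ m * Real.exp (-x) / (x + 1 / a) := by
  have hd : ∀ x ∈ Ici (0 : ℝ),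
      HasDerivAt (fun x : ℝ => x ^ m * Real.exp (-x) * Real.log (1 + a * x))
        (m * (x ^ (m - 1) * Real.exp (-x) * Real.log (1 + a * x)) -
          x ^ m * Real.exp (-x) * Real.log (1 + a * x) +
            x ^ m * Real.exp (-x) / (x + 1 / a)) x := by
    intro x hx
    have hx : (0 : ℝ) ≤ x := hx
    have hne : 1 + a * x ≠ 0 := by positivity
    have hne' : x + 1 / a ≠ 0 := by positivity
    have := ((hasDerivAt_pow m x).mul (hasDerivAt_neg x).exp).mul
      ((((hasDerivAt_id x).const_mul a).const_add 1).log hne)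
    refine this.congr_deriv ?_
    simp only [id, mul_one]
    have h2 : a / (1 + a * x) = 1 / (x + 1 / a) := by field_simp; ring
    rw [h2]
    simp only [Pi.mul_apply]
    ring
  have i1 := (integrableOn_pow_mul_exp_neg_mul_log (m - 1) ha).const_mul (m : ℝ)
  have i2 := integrableOn_pow_mul_exp_neg_mul_log m ha
  have i3 := integrableOn_pow_mul_exp_neg_div m (one_div_pos.mpr ha)
  have h := integral_Ioi_of_hasDerivAt_of_tendsto' (a := 0) hd ((i1.sub i2).add i3)
    (tendsto_zero_of_hasDerivAt_of_integrableOn_Ioi (fun x hx => hd x (Ioi_subset_Ici_self hx))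
      ((i1.sub i2).add i3) i2)
  rw [integral_add (by exact i1.sub i2) i3, integral_sub i1 i2, integral_const_mul] at h
  simp only [mul_zero, add_zero, Real.log_one, sub_zero] at h
  linarith

/-- Divided by m!, the recursion from integration by parts telescopes. -/
lemma integral_pow_mul_exp_neg_div_factorial_mul_log (m : ℕ) {a : ℝ} (ha : 0 < a) :
    ∫ x in Ioi (0 : ℝ), x ^ m * Real.exp (-x) / m.factorial * Real.log (1 + a * x) =
      ∑ k ∈ Finset.range (m + 1),
        (∫ x in Ioi (0 : ℝ), x ^ k * Real.exp (-x) / (x + 1 / a)) / k.factorial := by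
  have hfac : ∀ m : ℕ,
      ∫ x in Ioi (0 : ℝ), x ^ m * Real.exp (-x) / m.factorial * Real.log (1 + a * x) =
        (∫ x in Ioi (0 : ℝ), x ^ m * Real.exp (-x) * Real.log (1 + a * x)) / m.factorial := by
    intro m
    rw [← integral_div]
    congr 1 with x
    ring
  induction m with
  | zero =>
    rw [hfac, integral_pow_mul_exp_neg_mul_log 0 ha]
    simp
  | succ m ih =>
    rw [Finset.sum_range_succ, ← ih, hfac, hfac, integral_pow_mul_exp_neg_mul_log (m + 1) ha,
      Nat.factorial_succ]
    have : (m.factorial : ℝ) ≠ 0 := by exact_mod_cast Nat.factorial_ne_zero m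
    rw [Nat.add_sub_cancel]
    generalize ∫ x in Ioi (0 : ℝ), x ^ m * Real.exp (-x) * Real.log (1 + a * x) = A
    generalize ∫ x in Ioi (0 : ℝ), x ^ (m + 1) * Real.exp (-x) / (x + 1 / a) = B
    push_cast
    field_simp

lemma integral_log_one_add_mul_gammaMeasure {n : ℕ} (hn : 0 < n) {a : ℝ} (ha : 0 < a) :
    ∫ x, Real.log (1 + a * x) ∂gammaMeasure n 1 =
      ∑ v ∈ Finset.range n, 1 / ((n - 1 - v).factorial : ℝ) *
        ((-1) ^ (n - v) * Real.exp (1 / a) / a ^ (n - 1 - v) * expIntegralEi (-1 / a)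
          + ∑ u ∈ Finset.Icc 1 (n - 1 - v),
              ((u - 1).factorial : ℝ) * (-1 / a) ^ (n - 1 - v - u)) := by
  rw [integral_gammaMeasure_natCast hn]
  simp only [smul_eq_mul]
  rw [integral_pow_mul_exp_neg_div_factorial_mul_log (n - 1) ha, Nat.sub_add_cancel hn,
    -- The index v runs downwards: v corresponds to the power k = n - 1 - v.
    ← Finset.sum_range_reflect]
  refine Finset.sum_congr rfl fun v hv => ?_
  have hv : v < n := Finset.mem_range.mp hv
  rw [integral_pow_mul_exp_neg_div _ (one_div_pos.mpr ha), show n - 1 - v + 1 = n - v by omega,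
    neg_div, one_div_pow]
  ring

end GammaIntegrals


/-! ### The law of the channel gain -/

/-- The square avoids choosing a branch of the complex square root, and it is what the two
independent components of a complex Gaussian produce. -/
lemma integral_gaussianReal_cexp_sq {v : ℝ} (hv : 0 < v) (u : ℝ) :
    (∫ x, Complex.exp (u * x ^ 2 * Complex.I) ∂gaussianReal 0 (v / 2).toNNReal) ^ 2 =
      (1 - u * v * Complex.I)⁻¹ := by
  have hv2 : (v / 2).toNNReal ≠ 0 := by simpa using hv
  have hcoe : ((v / 2).toNNReal : ℝ) = v / 2 := Real.coe_toNNReal _ (by positivity)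
  have hb : 0 < ((v : ℂ)⁻¹ - u * Complex.I).re := by
    rw [← Complex.ofReal_inv]; simpa using hv
  have hint : ∫ x, Complex.exp (u * x ^ 2 * Complex.I) ∂gaussianReal 0 (v / 2).toNNReal =
      (((√(Real.pi * v))⁻¹ : ℝ) : ℂ) *
        ∫ x : ℝ, Complex.exp (-((v : ℂ)⁻¹ - u * Complex.I) * (x : ℂ) ^ 2) := by
    rw [integral_gaussianReal_eq_integral_smul hv2, ← integral_const_mul]
    congr 1 with x
    rw [gaussianPDFReal, hcoe, Complex.real_smul, Complex.ofReal_mul, mul_assoc,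
      Complex.ofReal_exp, ← Complex.exp_add]
    have h2 : 2 * Real.pi * (v / 2) = Real.pi * v := by ring
    rw [h2]
    congr 2
    push_cast
    field_simp
    ring
  have hb0 : (v : ℂ)⁻¹ - u * Complex.I ≠ 0 := by intro h; rw [h] at hb; simp at hb
  have hv0 : (v : ℂ) ≠ 0 := by exact_mod_cast hv.ne'
  have hpi : (Real.pi : ℂ) ≠ 0 := by exact_mod_cast Real.pi_ne_zero
  rw [hint, mul_pow, integral_gaussian_sq_complex hb, ← Complex.ofReal_pow, inv_pow,
    Real.sq_sqrt (by positivity)]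
  have h1 : (1 - u * v * Complex.I : ℂ) = v * ((v : ℂ)⁻¹ - u * Complex.I) := by
    field_simp
  rw [h1]
  push_cast
  field_simp

lemma norm_sq_measurableEquivRealProd_symm (p : ℝ × ℝ) :
    ‖Complex.measurableEquivRealProd.symm p‖ ^ 2 = p.1 ^ 2 + p.2 ^ 2 := by
  rw [← Complex.normSq_eq_norm_sq, Complex.normSq_apply]
  simp [Complex.measurableEquivRealProd, sq]

lemma integral_circularGaussian_cexp_norm_sq {v : ℝ} (hv : 0 < v) (u : ℝ) :
    ∫ z, Complex.exp (u * (‖z‖ ^ 2 : ℝ) * Complex.I) ∂circularGaussian v =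
      (1 - u * v * Complex.I)⁻¹ := by
  rw [circularGaussian, integral_map_equiv, ← integral_gaussianReal_cexp_sq hv, sq,
    ← integral_prod_mul]
  congr 1 with p
  rw [norm_sq_measurableEquivRealProd_symm, ← Complex.exp_add]
  push_cast
  ring_nf

lemma integrable_norm_sq_circularGaussian (v : ℝ) :
    Integrable (fun z : ℂ => ‖z‖ ^ 2) (circularGaussian v) := by
  rw [circularGaussian, integrable_map_equiv]
  have h : Integrable (fun x : ℝ => x ^ 2) (gaussianReal 0 (v / 2).toNNReal) :=
    (memLp_id_gaussianReal 2).integrable_sq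
  exact ((h.comp_fst _).add (h.comp_snd _)).congr
    (ae_of_all _ fun p => (norm_sq_measurableEquivRealProd_symm p).symm)

lemma channelGain_eq_sum {D : ℕ} (h : Fin D → ℂ) : channelGain h = ∑ j, ‖h j‖ ^ 2 := by
  simp [channelGain, EuclideanSpace.norm_sq_eq]

/-- The mixture of the Gamma distributions of shapes `D + q` with weights `mixtureWeight V q`. -/
def gammaMixture {D : ℕ} (V : Fin D → ℝ) : Measure ℝ :=
  Measure.sum fun q => ENNReal.ofReal (mixtureWeight V q) • gammaMeasure ((D + q : ℕ) : ℝ) 1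

/-! ### The Gamma mixture and its identification with the normalized gain -/

section Mixture

variable {D : ℕ} {V : Fin D → ℝ}

lemma tsum_ofReal_mixtureWeight (hD : 1 ≤ D) (hV : ∀ j, 0 < V j) :
    ∑' q, ENNReal.ofReal (mixtureWeight V q) = 1 := by
  rw [← ENNReal.ofReal_tsum_of_nonneg (mixtureWeight_nonneg hD hV)
    (hasSum_mixtureWeight hD hV).summable,
    (hasSum_mixtureWeight hD hV).tsum_eq, ENNReal.ofReal_one]

lemma isProbabilityMeasure_gammaMixture (hD : 1 ≤ D) (hV : ∀ j, 0 < V j) :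
    IsProbabilityMeasure (gammaMixture V) := by
  constructor
  have h : ∀ q, gammaMeasure ((D + q : ℕ) : ℝ) 1 Set.univ = 1 := fun q =>
    (isProbabilityMeasure_gammaMeasure (by exact_mod_cast (by omega : 0 < D + q))
      one_pos).measure_univ
  rw [gammaMixture, Measure.sum_apply _ MeasurableSet.univ]
  simp only [Measure.smul_apply, h, smul_eq_mul, mul_one]
  exact tsum_ofReal_mixtureWeight hD hV

lemma gammaMixture_le_volume (hD : 1 ≤ D) (hV : ∀ j, 0 < V j) : gammaMixture V ≤ volume := by
  refine Measure.le_iff.mpr fun s hs => ?_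
  rw [gammaMixture, Measure.sum_apply _ hs]
  calc ∑' q, (ENNReal.ofReal (mixtureWeight V q) • gammaMeasure ((D + q : ℕ) : ℝ) 1) s
      ≤ ∑' q, ENNReal.ofReal (mixtureWeight V q) * volume s := by
        refine ENNReal.tsum_le_tsum fun q => ?_
        rw [Measure.smul_apply, smul_eq_mul]
        gcongr
        exact gammaMeasure_natCast_le_volume (by omega)
    _ = volume s := by rw [ENNReal.tsum_mul_right, tsum_ofReal_mixtureWeight hD hV, one_mul]

lemma gammaMixture_Iic_zero (V : Fin D → ℝ) : gammaMixture V (Set.Iic 0) = 0 := by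
  rw [gammaMixture, Measure.sum_apply _ measurableSet_Iic]
  simp [gammaMeasure_Iic_zero]

lemma ae_gammaMixture_pos (V : Fin D → ℝ) : ∀ᵐ x ∂gammaMixture V, 0 < x := by
  rw [ae_iff]
  simpa [Set.Iic] using gammaMixture_Iic_zero V

lemma hasSum_integral_gammaMixture (hD : 1 ≤ D) (hV : ∀ j, 0 < V j)
    {E : Type*} [NormedAddCommGroup E] [NormedSpace ℝ E] {f : ℝ → E}
    (hf : Integrable f (gammaMixture V)) :
    HasSum (fun q => mixtureWeight V q • ∫ x, f x ∂gammaMeasure ((D + q : ℕ) : ℝ) 1)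
      (∫ x, f x ∂gammaMixture V) := by
  have h := hasSum_integral_measure hf
  simp only [integral_smul_measure, ENNReal.toReal_ofReal (mixtureWeight_nonneg hD hV _)] at h
  exact h

lemma charFun_gammaMixture (hD : 1 ≤ D) (hV : ∀ j, 0 < V j) (t : ℝ) :
    charFun (gammaMixture V) t = ∏ j, (1 - (t / minVar V : ℝ) * V j * Complex.I)⁻¹ := by
  have := isProbabilityMeasure_gammaMixture hD hV
  have hint : Integrable (fun x : ℝ => Complex.exp (t * x * Complex.I)) (gammaMixture V) := by
    refine (integrable_const (1 : ℝ)).mono' (by fun_prop) (ae_of_all _ fun x => ?_)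
    rw [← Complex.ofReal_mul, Complex.norm_exp_ofReal_mul_I]
  have h1 := hasSum_integral_gammaMixture hD hV hint
  have hc : (1 : ℂ) - t * Complex.I ≠ 0 := by
    intro h
    simpa using congrArg Complex.re h
  -- The real part of 1 - i t is 1, so w = (1 - i t)⁻¹ lies in the closed disc where the weight
  -- series converges.
  have hz : ‖((1 : ℂ) - t * Complex.I)⁻¹‖ ≤ 1 := by
    rw [norm_inv]
    refine inv_le_one_of_one_le₀ ((?_ : (1 : ℝ) ≤ _).trans (Complex.abs_re_le_norm _))
    simp
  have h2 := (hasSum_mixtureWeight_mul_pow hD hV hz).mul_left (((1 : ℂ) - t * Complex.I)⁻¹ ^ D)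
  rw [charFun_apply_real]
  have h3 : ∀ q, mixtureWeight V q • ∫ x : ℝ, Complex.exp (t * x * Complex.I)
      ∂gammaMeasure ((D + q : ℕ) : ℝ) 1 = ((1 : ℂ) - t * Complex.I)⁻¹ ^ D *
        (mixtureWeight V q * ((1 : ℂ) - t * Complex.I)⁻¹ ^ q) := by
    intro q
    rw [← charFun_apply_real, charFun_gammaMeasure_natCast (by omega), pow_add, Complex.real_smul]
    ring
  simp only [h3] at h1
  rw [h1.unique h2, ← Fin.prod_const, ← Finset.prod_mul_distrib]
  refine Finset.prod_congr rfl fun j _ => ?_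
  have hm : (minVar V : ℂ) ≠ 0 := by exact_mod_cast (minVar_pos hD hV).ne'
  have hv : (V j : ℂ) ≠ 0 := by exact_mod_cast (hV j).ne'
  have hden : (minVar V : ℂ) - t * V j * Complex.I ≠ 0 := by
    intro h
    have := congrArg Complex.re h
    simp at this
    exact (minVar_pos hD hV).ne' this
  have e1 : (1 : ℂ) - (t / minVar V : ℝ) * V j * Complex.I =
      (minVar V - t * V j * Complex.I) / minVar V := by
    push_cast
    field_simp
  have e2 : (1 : ℂ) - ((1 - minVar V / V j : ℝ) : ℂ) * (1 - t * Complex.I)⁻¹ =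
      (minVar V - t * V j * Complex.I) / V j * (1 - t * Complex.I)⁻¹ := by
    push_cast
    field_simp
    ring
  rw [e1, e2]
  push_cast
  field_simp

variable {Ω : Type*} [MeasurableSpace Ω] {P : Measure Ω}
  {h : Fin D → Ω → ℂ}

lemma integrable_channelGain (hlaw : ∀ j, HasLaw (h j) (circularGaussian (V j)) P) :
    Integrable (fun ω => channelGain fun j => h j ω) P := by
  simp only [channelGain_eq_sum]
  refine integrable_finsetSum _ fun j _ => ?_
  have := integrable_norm_sq_circularGaussian (V j)
  rw [← (hlaw j).map_eq] at this
  exact this.comp_aemeasurable (hlaw j).aemeasurable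

/-- The channel gain in units of the smallest variance is a mixture of Gamma variables. -/
lemma hasLaw_channelGain_div_minVar [IsProbabilityMeasure P] (hD : 1 ≤ D) (hV : ∀ j, 0 < V j)
    (hlaw : ∀ j, HasLaw (h j) (circularGaussian (V j)) P) (hindep : iIndepFun h P) :
    HasLaw (fun ω => channelGain (fun j => h j ω) / minVar V) (gammaMixture V) P where
  aemeasurable := (integrable_channelGain hlaw).aemeasurable.div_const _
  map_eq := by
    have := isProbabilityMeasure_gammaMixture hD hV
    have hmeas : Measurable fun z : ℂ => ‖z‖ ^ 2 / minVar V := by fun_prop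
    have hae : ∀ j, AEMeasurable (fun ω => ‖h j ω‖ ^ 2 / minVar V) P := fun j =>
      hmeas.comp_aemeasurable (hlaw j).aemeasurable
    have hind : iIndepFun (fun j ω => ‖h j ω‖ ^ 2 / minVar V) P :=
      hindep.comp (fun _ z => ‖z‖ ^ 2 / minVar V) fun _ => hmeas
    have : IsProbabilityMeasure (P.map fun ω => ∑ j, ‖h j ω‖ ^ 2 / minVar V) :=
      Measure.isProbabilityMeasure_map (Finset.aemeasurable_fun_sum _ fun j _ => hae j)
    simp only [channelGain_eq_sum, Finset.sum_div]
    refine Measure.ext_of_charFun ?_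
    ext t
    -- By independence both sides are products over j, compared factor by factor.
    rw [hind.charFun_map_fun_sum_eq_prod hae, charFun_gammaMixture hD hV, Finset.prod_apply]
    refine Finset.prod_congr rfl fun j _ => ?_
    rw [charFun_apply_real, integral_map (hae j) (by fun_prop),
      ← integral_circularGaussian_cexp_norm_sq (hV j), ← (hlaw j).map_eq,
      integral_map (hlaw j).aemeasurable (by fun_prop)]
    congr 1 with ω
    push_cast
    ring_nf

/-- On (0, 1] the mixture is dominated by Lebesgue measure, for which log is integrable; beyond 1,
log x ≤ x and the first moment is finite. -/
lemma integrable_log_gammaMixture (hD : 1 ≤ D) (hV : ∀ j, 0 < V j)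
    (hid : Integrable id (gammaMixture V)) : Integrable Real.log (gammaMixture V) := by
  have h1 : IntegrableOn Real.log (Set.Iic 0) (gammaMixture V) := by
    rw [IntegrableOn, Measure.restrict_eq_zero.mpr (gammaMixture_Iic_zero V)]
    exact integrable_zero_measure
  have h2 : IntegrableOn Real.log (Set.Ioc 0 1) (gammaMixture V) := by
    have : IntegrableOn Real.log (Set.Ioc 0 1) volume :=
      (intervalIntegrable_iff_integrableOn_Ioc_of_le zero_le_one).mp
        intervalIntegral.intervalIntegrable_log'
    exact this.mono_measure (gammaMixture_le_volume hD hV)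
  have h3 : IntegrableOn Real.log (Set.Ioi 1) (gammaMixture V) := by
    refine hid.integrableOn.mono' (by fun_prop)
      ((ae_restrict_mem measurableSet_Ioi).mono fun x hx => ?_)
    have hx : (1 : ℝ) < x := hx
    rw [Real.norm_of_nonneg (Real.log_nonneg hx.le)]
    have := Real.log_le_sub_one_of_pos (x := x) (by linarith)
    simp only [id]
    linarith
  have h := h1.union (h2.union h3)
  rwa [Set.Ioc_union_Ioi_eq_Ioi zero_le_one, Set.Iic_union_Ioi, integrableOn_univ] at h

end Mixture


/-! ### The series of the average rate and of the power offset -/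

lemma integrable_log_one_add {Ω : Type*} [MeasurableSpace Ω] {P : Measure Ω} {Y : Ω → ℝ}
    (hpos : ∀ᵐ ω ∂P, 0 < Y ω) (hY : Integrable Y P) :
    Integrable (fun ω => Real.log (1 + Y ω)) P := by
  refine hY.mono' ?_ (hpos.mono fun ω hω => ?_)
  · exact (Real.measurable_log.comp_aemeasurable
      (aemeasurable_const.add hY.aemeasurable)).aestronglyMeasurable
  · have h0 := log_one_add_mul_nonneg one_pos hω
    have h1 := log_one_add_mul_le one_pos hω
    rw [one_mul] at h0 h1
    rwa [Real.norm_of_nonneg h0]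

section Series

variable {D : ℕ} {V : Fin D → ℝ}

lemma rateTerm_eq_integral (hD : 1 ≤ D) (V : Fin D → ℝ) {a : ℝ} (ha : 0 < a) (q : ℕ) :
    rateTerm V a q = seriesCoeff V q *
      (∫ x, Real.log (1 + a * x) ∂gammaMeasure ((D + q : ℕ) : ℝ) 1) / Real.log 2 := by
  rw [integral_log_one_add_mul_gammaMeasure (by omega) ha, rateTerm, Finset.mul_sum,
    Finset.sum_div]
  refine Finset.sum_congr rfl fun v _ => ?_
  ring

/-- No estimate of the terms is needed: integrability against the mixture already makes the series
of component integrals converge unconditionally, hence absolutely. -/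
lemma hasSum_rateTerm (hD : 1 ≤ D) (hV : ∀ j, 0 < V j) (hid : Integrable id (gammaMixture V))
    {a : ℝ} (ha : 0 < a) :
    HasSum (fun q => prefactor V * rateTerm V a q)
      ((∫ x, Real.log (1 + a * x) ∂gammaMixture V) / Real.log 2) := by
  have h := (hasSum_integral_gammaMixture hD hV (integrable_log_one_add (Y := fun x => a * x)
    ((ae_gammaMixture_pos V).mono fun x hx => mul_pos ha hx) (hid.const_mul a))).div_const
      (Real.log 2)
  have hterm : ∀ q, prefactor V * rateTerm V a q = (mixtureWeight V q •
      ∫ x, Real.log (1 + a * x) ∂gammaMeasure ((D + q : ℕ) : ℝ) 1) / Real.log 2 := fun q => by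
    rw [rateTerm_eq_integral hD V ha, mixtureWeight, smul_eq_mul]
    ring
  simp only [hterm]
  exact h

lemma hasSum_offsetTerm (hD : 1 ≤ D) (hV : ∀ j, 0 < V j) (hid : Integrable id (gammaMixture V)) :
    HasSum (fun q => prefactor V * offsetTerm V q)
      (((∫ x, Real.log x ∂gammaMixture V) + Real.log (minVar V)) / Real.log 2) := by
  have h := ((hasSum_integral_gammaMixture hD hV (integrable_log_gammaMixture hD hV hid)).add
    ((hasSum_mixtureWeight hD hV).mul_right (Real.log (minVar V)))).div_const (Real.log 2)
  rw [one_mul] at h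
  have hterm : ∀ q, prefactor V * offsetTerm V q = (mixtureWeight V q •
      ∫ x, Real.log x ∂gammaMeasure ((D + q : ℕ) : ℝ) 1 +
        mixtureWeight V q * Real.log (minVar V)) / Real.log 2 := fun q => by
    rw [integral_log_gammaMeasure (by omega), offsetTerm, mixtureWeight, smul_eq_mul]
    ring
  simp only [hterm]
  exact h

end Series

/-! ### Asymptotics at high signal-to-noise ratio -/

lemma tendsto_div_of_tendsto_sub {α : Type*} {l : Filter α} {f g : α → ℝ} {c : ℝ}
    (hfg : Tendsto (fun x => f x - g x) l (𝓝 c)) (hg : Tendsto g l atTop) :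
    Tendsto (fun x => f x / g x) l (𝓝 1) := by
  have h := (hfg.div_atTop hg).add_const 1
  rw [zero_add] at h
  refine h.congr' ?_
  filter_upwards [hg.eventually_gt_atTop 0] with x hx
  field_simp
  ring

lemma tendsto_integral_log_one_add_mul {Ω : Type*} [MeasurableSpace Ω] {P : Measure Ω}
    [IsProbabilityMeasure P] {Y : Ω → ℝ} (hpos : ∀ᵐ ω ∂P, 0 < Y ω) (hY : Integrable Y P)
    (hlog : Integrable (fun ω => Real.log (Y ω)) P) :
    Tendsto (fun γ : ℝ => ∫ ω, Real.log (1 + γ * Y ω) ∂P - Real.log γ) atTop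
      (𝓝 (∫ ω, Real.log (Y ω) ∂P)) := by
  have h : Tendsto (fun γ : ℝ => ∫ ω, Real.log (γ⁻¹ + Y ω) ∂P) atTop
      (𝓝 (∫ ω, Real.log (Y ω) ∂P)) := by
    refine tendsto_integral_filter_of_dominated_convergence
      -- For γ ≥ 1, log Y ≤ log(γ⁻¹ + Y) ≤ γ⁻¹ + Y - 1 ≤ Y.
      (fun ω => |Real.log (Y ω)| + Y ω) (Eventually.of_forall fun γ => ?_) ?_
      (hlog.abs.add hY) (hpos.mono fun ω hω => ?_)
    · exact (Real.measurable_log.comp_aemeasurable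
        (aemeasurable_const.add hY.aemeasurable)).aestronglyMeasurable
    · filter_upwards [eventually_ge_atTop 1] with γ hγ
      filter_upwards [hpos] with ω hω
      have hγ0 : 0 < γ⁻¹ := by positivity
      have hγ1 : γ⁻¹ ≤ 1 := inv_le_one_of_one_le₀ hγ
      have hlow : Real.log (Y ω) ≤ Real.log (γ⁻¹ + Y ω) := Real.log_le_log hω (by linarith)
      have hupp := Real.log_le_sub_one_of_pos (x := γ⁻¹ + Y ω) (by linarith)
      rw [Real.norm_eq_abs, abs_le]
      constructor <;> linarith [neg_abs_le (Real.log (Y ω)), abs_nonneg (Real.log (Y ω))]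
    · have ht : Tendsto (fun γ : ℝ => γ⁻¹ + Y ω) atTop (𝓝 (Y ω)) := by
        simpa using tendsto_inv_atTop_zero.add_const (Y ω)
      exact ht.log hω.ne'
  refine h.congr' ?_
  filter_upwards [eventually_gt_atTop 0] with γ hγ
  have hint := integrable_log_one_add (P := P) (Y := fun ω => γ * Y ω)
    (hpos.mono fun ω hω => mul_pos hγ hω) (hY.const_mul γ)
  have hconst : ∫ _, Real.log γ ∂P = Real.log γ := by simp
  rw [← hconst, ← integral_sub hint (integrable_const _)]
  refine integral_congr_ae (hpos.mono fun ω hω => ?_)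
  have he : 1 + γ * Y ω = γ * (γ⁻¹ + Y ω) := by field_simp
  simp only [he]
  rw [Real.log_mul hγ.ne' (by positivity), add_sub_cancel_left]

lemma tendsto_logb_one_add_sub_logb :
    Tendsto (fun γ : ℝ => Real.logb 2 (1 + γ) - Real.logb 2 γ) atTop (𝓝 0) := by
  have ht : Tendsto (fun γ : ℝ => Real.log (γ⁻¹ + 1)) atTop (𝓝 0) := by
    have h1 : Tendsto (fun γ : ℝ => γ⁻¹ + 1) atTop (𝓝 1) := by
      simpa using tendsto_inv_atTop_zero.add_const (1 : ℝ)
    simpa using h1.log one_ne_zero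
  have h := ht.div_const (Real.log 2)
  rw [zero_div] at h
  refine h.congr' ?_
  filter_upwards [eventually_gt_atTop 0] with γ hγ
  have he : 1 + γ = γ * (γ⁻¹ + 1) := by field_simp
  rw [Real.logb, Real.logb, he, Real.log_mul hγ.ne' (by positivity)]
  ring

lemma tendsto_logb_two_atTop : Tendsto (Real.logb 2) atTop atTop :=
  Real.tendsto_logb_atTop one_lt_two

lemma volume_real_aperture_pos {Lx Lz : ℝ} (hx : 0 < Lx) (hz : 0 < Lz) :
    0 < volume.real (aperture Lx Lz) := by
  rw [aperture, Measure.volume_eq_prod, measureReal_prod_prod, Real.volume_real_Icc,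
    Real.volume_real_Icc]
  have h1 : 0 < Lx / 2 - -(Lx / 2) := by linarith
  have h2 : 0 < Lz / 2 - -(Lz / 2) := by linarith
  exact mul_pos (lt_max_of_lt_left h1) (lt_max_of_lt_left h2)

end CAPA

end

/-! ### Assembly of the theorem -/

theorem theorem2 {Ω : Type*} [MeasurableSpace Ω] (P : Measure Ω) [IsProbabilityMeasure P]
    (D : ℕ) (hD : 1 ≤ D) (V : Fin D → ℝ) (hV : ∀ j, 0 < V j)
    (h : Fin D → Ω → ℂ) (hlaw : ∀ j, HasLaw (h j) (CAPA.circularGaussian (V j)) P)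
    (hindep : iIndepFun h P)
    (Ltx Ltz Lrx Lrz : ℝ) (hLtx : 0 < Ltx) (hLtz : 0 < Ltz) (hLrx : 0 < Lrx) (hLrz : 0 < Lrz)
    (μt : ℝ)
    (hμt : μt = volume.real (CAPA.aperture Ltx Ltz) * volume.real (CAPA.aperture Lrx Lrz) / D) :
    -- the explicit average data rate, at every SNR
    (∀ γ : ℝ, 0 < γ →
      Integrable (fun ω => CAPA.misoRate μt γ (fun j => h j ω)) P ∧
      Summable (CAPA.rateTerm V (γ * μt * CAPA.minVar V)) ∧
      CAPA.averageRate P h μt γ =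
        CAPA.prefactor V * ∑' q, CAPA.rateTerm V (γ * μt * CAPA.minVar V) q) ∧
    -- the high-SNR asymptotics, as a vanishing difference and as a ratio tending to one
    Tendsto (fun γ => CAPA.averageRate P h μt γ - (Real.logb 2 γ - CAPA.powerOffset P h μt))
      atTop (𝓝 0) ∧
    Tendsto (fun γ => CAPA.averageRate P h μt γ / (Real.logb 2 γ - CAPA.powerOffset P h μt))
      atTop (𝓝 1) ∧
    -- the power offset
    Integrable (fun ω => Real.logb 2 (μt * CAPA.channelGain (fun j => h j ω))) P ∧
    Summable (CAPA.offsetTerm V) ∧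
    CAPA.powerOffset P h μt =
      -Real.logb 2 μt - CAPA.prefactor V * ∑' q, CAPA.offsetTerm V q ∧
    -- the maximal multiplexing gain
    Tendsto (fun γ => CAPA.averageRate P h μt γ / Real.logb 2 (1 + γ)) atTop (𝓝 1) := by
  have hμ : 0 < μt := by
    rw [hμt]
    have hD' : (0 : ℝ) < D := by exact_mod_cast hD
    have := CAPA.volume_real_aperture_pos hLtx hLtz
    have := CAPA.volume_real_aperture_pos hLrx hLrz
    positivity
  have hσ := CAPA.minVar_pos hD hV
  have hC := CAPA.prefactor_pos hD hV
  set σ := CAPA.minVar V with hσdef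
  set X : Ω → ℝ := fun ω => CAPA.channelGain (fun j => h j ω) / σ with hX
  have hXlaw : HasLaw X (CAPA.gammaMixture V) P :=
    CAPA.hasLaw_channelGain_div_minVar hD hV hlaw hindep
  have hgain : ∀ ω, CAPA.channelGain (fun j => h j ω) = σ * X ω := fun ω => by
    rw [hX]; field_simp
  have hXint : Integrable X P := (CAPA.integrable_channelGain hlaw).div_const σ
  -- The mixture's finite first moment is read off from the channel gain, avoiding a series of Gamma
  -- means.
  have hid : Integrable id (CAPA.gammaMixture V) := by
    rw [← hXlaw.map_eq]
    exact (integrable_map_measure (by fun_prop) hXlaw.aemeasurable).mpr hXint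
  have hXpos : ∀ᵐ ω ∂P, 0 < X ω :=
    (hXlaw.ae_iff (p := fun x => 0 < x) (measurableSet_setOfPred.mp measurableSet_Ioi)).mpr (CAPA.ae_gammaMixture_pos V)
  have hXlog : Integrable (fun ω => Real.log (X ω)) P := by
    have := CAPA.integrable_log_gammaMixture hD hV hid
    rw [← hXlaw.map_eq] at this
    exact this.comp_aemeasurable hXlaw.aemeasurable
  have hXlog_eq : ∫ ω, Real.log (X ω) ∂P = ∫ x, Real.log x ∂CAPA.gammaMixture V :=
    hXlaw.integral_comp Real.measurable_log.aestronglyMeasurable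
  have hYpos : ∀ᵐ ω ∂P, 0 < μt * CAPA.channelGain (fun j => h j ω) := by
    filter_upwards [hXpos] with ω hω
    rw [hgain]
    positivity
  have hYint : Integrable (fun ω => μt * CAPA.channelGain (fun j => h j ω)) P :=
    (CAPA.integrable_channelGain hlaw).const_mul μt
  have hYlog_eq : (fun ω => Real.log (μt * CAPA.channelGain (fun j => h j ω))) =ᵐ[P]
      fun ω => Real.log μt + Real.log σ + Real.log (X ω) := by
    filter_upwards [hXpos] with ω hω
    rw [hgain, Real.log_mul hμ.ne' (by positivity), Real.log_mul hσ.ne' hω.ne', add_assoc]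
  have hYlog : Integrable (fun ω => Real.log (μt * CAPA.channelGain (fun j => h j ω))) P :=
    (((integrable_const _).add hXlog).congr hYlog_eq.symm)
  have hoffset : CAPA.powerOffset P h μt =
      -((∫ ω, Real.log (μt * CAPA.channelGain (fun j => h j ω)) ∂P) / Real.log 2) := by
    simp only [CAPA.powerOffset, Real.logb, integral_div]
  have hrate : ∀ γ, CAPA.averageRate P h μt γ =
      (∫ ω, Real.log (1 + γ * (μt * CAPA.channelGain (fun j => h j ω))) ∂P) / Real.log 2 := by
    intro γ
    rw [CAPA.averageRate, ← integral_div]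
    congr 1 with ω
    rw [CAPA.misoRate, Real.logb]
    ring_nf
  have hlim : Tendsto (fun γ => CAPA.averageRate P h μt γ - Real.logb 2 γ) atTop
      (𝓝 (-CAPA.powerOffset P h μt)) := by
    rw [hoffset, neg_neg]
    refine ((CAPA.tendsto_integral_log_one_add_mul hYpos hYint hYlog).div_const
      (Real.log 2)).congr fun γ => ?_
    rw [hrate, Real.logb, sub_div]
  have hdiff : Tendsto
      (fun γ => CAPA.averageRate P h μt γ - (Real.logb 2 γ - CAPA.powerOffset P h μt))
      atTop (𝓝 0) := by
    have := hlim.add_const (CAPA.powerOffset P h μt)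
    rw [neg_add_cancel] at this
    exact this.congr fun γ => by ring
  refine ⟨fun γ hγ => ?_, hdiff, ?_, hYlog.div_const _, ?_, ?_, ?_⟩
  · have ha : 0 < γ * μt * σ := by positivity
    have hsum := CAPA.hasSum_rateTerm hD hV hid ha
    refine ⟨?_, (summable_mul_left_iff hC.ne').mp hsum.summable, ?_⟩
    · have := (CAPA.integrable_log_one_add (hYpos.mono fun ω hω => mul_pos hγ hω)
        (hYint.const_mul γ)).div_const (Real.log 2)
      refine this.congr (ae_of_all _ fun ω => ?_)
      simp only [CAPA.misoRate, Real.logb]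
      ring_nf
    · rw [← tsum_mul_left, hsum.tsum_eq, hrate, ← hXlaw.integral_comp
        (f := fun x => Real.log (1 + γ * μt * σ * x))
        (by refine Measurable.aestronglyMeasurable ?_; fun_prop)]
      congr 2 with ω
      rw [hgain, Function.comp_apply]
      ring_nf
  · exact CAPA.tendsto_div_of_tendsto_sub hdiff
      (tendsto_atTop_add_const_right _ _ CAPA.tendsto_logb_two_atTop)
  · exact (summable_mul_left_iff hC.ne').mp (CAPA.hasSum_offsetTerm hD hV hid).summable
  · rw [← tsum_mul_left, (CAPA.hasSum_offsetTerm hD hV hid).tsum_eq, hoffset,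
      integral_congr_ae hYlog_eq, integral_add (integrable_const _) hXlog, hXlog_eq,
      integral_const, probReal_univ, one_smul, Real.logb]
    ring
  -- Any finite limit of the difference suffices here; the 0 is the limit of log₂(1 + γ) - log₂ γ.
  · refine CAPA.tendsto_div_of_tendsto_sub (c := -CAPA.powerOffset P h μt - 0) ?_
      (CAPA.tendsto_logb_two_atTop.comp (tendsto_atTop_add_const_left _ 1 tendsto_id))
    exact (hlim.sub CAPA.tendsto_logb_one_add_sub_logb).congr fun γ => by
      ring_nf
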